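/- **Setting.** Fix $d,t\in\mathbb N$. A $t$-online-erasure oracle for $f:\{0,1\}^d\to\{0,1\}$ answers a query $x$ by $f(x)$ if $x$ has not been erased, and by $\perp$ otherwise; after answering each query it erases at most $t$ points of $\{0,1\}^d$, permanently. The erased points are chosen by an arbitrary (possibly randomized) strategy, which may depend on $f$, on the description of the tester and on the queries made so far, but not on the tester's future coin tosses. A function $f$ is *linear* if $f(x)=\sum_{i\in S}x[i] \pmod 2$ for some $S\subseteq\{1,\dots,d\}$, and *$\varepsilon$-far from linear* if it differs from every linear function on at least $\varepsilon 2^d$ points. A *$t$-online-erasure-resilient $\varepsilon$-tester for linearity* is a randomized algorithm that accesses $f$ via a $t$-online-erasure oracle and, for every $f$ and every strategy of the oracle, accepts with probability at least $2/3$ if $f$ is linear and rejects with probability at least $2/3$ if $f$ is $\varepsilon$-far from linear. It has *1-sided error* if it accepts every linear $f$ with probability $1$, and it is *nonadaptive* if its queries do not depend on the answers to previous queries. **Theorem 1.1.** There exist constants $c_0\in(0,1)$ and $C>0$ and an algorithm with parameters $d\in\mathbb N$, $\varepsilon\in(0,1)$ and $t\in\mathbb N$, $t\ge 1$, such that, whenever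 $$t\le c_0\,\varepsilon^{5/4}\,2^{d/4},$$ the algorithm is a 1-sided error, nonadaptive, $t$-online-erasure-resilient $\varepsilon$-tester for linearity of functions $f:\{0,1\}^d\to\{0,1\}$ and always makes at most $$C\cdot\min\Big(\frac1\varepsilon\log_2\frac t\varepsilon,\ \frac t\varepsilon\Big)$$ queries. -/

import Mathlib

namespace OnlineErasure

/-- A deterministic, possibly adaptive, query algorithm for input objects `f : X → R`: a decision
tree. It either stops, accepting (`true`) or rejecting (`false`), or it queries a point `x` and
continues as `next a`, where `a` is the answer of the oracle; the answer `none` is the erasure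
symbol `⊥`. -/
inductive QueryAlg (X R : Type) : Type
  | output (accept : Bool) : QueryAlg X R
  | query (x : X) (next : Option R → QueryAlg X R) : QueryAlg X R

/-- A deterministic strategy of a `t`-online-erasure oracle: after answering a query, it chooses
at most `t` points to erase, as a function of all the queries made so far (listed with the most
recent query first). A strategy is always chosen after the input and the tester are fixed,
so it may depend on these. -/
def Strategy (X : Type) (t : ℕ) : Type :=
  List X → {E : Finset X // E.card ≤ t}

namespace QueryAlg

variable {X R : Type}

/-- The final decision of an algorithm that accesses `f` through the online-erasure oracle with
strategy `S`, when `hist` is the list of the queries made before and `E` is the set of the points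
erased before. A query `x` is answered first, by `⊥` if `x` is already erased and by `f x`
otherwise, and then the points chosen by the strategy are erased. -/
def run [DecidableEq X] {t : ℕ} (S : Strategy X t) (f : X → R) :
    QueryAlg X R → List X → Finset X → Bool
  | output b, _, _ => b
  | query x next, hist, E =>
      (next (if x ∈ E then none else some (f x))).run S f (x :: hist)
        (E ∪ (S (x :: hist)).1)

/-- The worst-case number of queries, over all sequences of answers. -/
def numQueries [Fintype R] : QueryAlg X R → ℕ
  | output _ => 0
  | query _ next => 1 + Finset.univ.sup fun a => (next a).numQueries

/-- The algorithm makes exactly the queries in the list, in this order, whatever the answers. -/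
def HasQueries : QueryAlg X R → List X → Prop
  | output _, l => l = []
  | query x next, l => ∃ l', l = x :: l' ∧ ∀ a, (next a).HasQueries l'

/-- A deterministic algorithm whose queries do not depend on the answers to previous queries. -/
def IsNonadaptive (A : QueryAlg X R) : Prop :=
  ∃ l, A.HasQueries l

end QueryAlg

/-- A randomized query algorithm: a probability distribution on deterministic algorithms. -/
abbrev RandAlg (X R : Type) : Type := PMF (QueryAlg X R)

/-- A (randomized) strategy of a `t`-online-erasure oracle: a probability distribution on
deterministic strategies. -/
abbrev RandStrategy (X : Type) (t : ℕ) : Type := PMF (Strategy X t)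

/-- The distribution of the decision (`true` is accept, `false` is reject) of the randomized
algorithm `T` with access to `f` through the online-erasure oracle with strategy `σ`.
The coins of the algorithm and of the oracle are independent; at the beginning nothing is
erased. -/
noncomputable def outcome {X R : Type} [DecidableEq X] {t : ℕ} (T : RandAlg X R)
    (σ : RandStrategy X t) (f : X → R) : PMF Bool :=
  T.bind fun A => σ.map fun S => A.run S f [] ∅

/-- `f` is `ε`-far from the property `P`: it differs from every function in `P` on at least an
`ε` fraction of the domain. -/
def IsFar {X R : Type} [Fintype X] [DecidableEq R] (ε : ℝ) (P : Set (X → R)) (f : X → R) : Prop :=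
  ∀ g ∈ P, ε * (Fintype.card X : ℝ) ≤ ((Finset.univ.filter fun x => f x ≠ g x).card : ℝ)

/-- `T` is a `t`-online-erasure-resilient `ε`-tester for the property `P`. -/
def IsTester {X R : Type} [Fintype X] [DecidableEq X] [DecidableEq R] (t : ℕ) (ε : ℝ)
    (P : Set (X → R)) (T : RandAlg X R) : Prop :=
  ∀ (f : X → R) (σ : RandStrategy X t),
    (f ∈ P → 2 / 3 ≤ outcome T σ f true) ∧ (IsFar ε P f → 2 / 3 ≤ outcome T σ f false)

/-- 1-sided error: functions with the property are always accepted. -/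
def IsOneSided {X R : Type} [DecidableEq X] (t : ℕ) (P : Set (X → R)) (T : RandAlg X R) : Prop :=
  ∀ f ∈ P, ∀ σ : RandStrategy X t, outcome T σ f true = 1

/-- A randomized algorithm is nonadaptive if its queries depend only on its coins. -/
def IsNonadaptive {X R : Type} (T : RandAlg X R) : Prop :=
  ∀ A ∈ T.support, A.IsNonadaptive

/-- The points of `{0,1}^d`; addition is bitwise XOR. -/
abbrev Cube (d : ℕ) : Type := Fin d → ZMod 2

/-- The linear functions `{0,1}^d → {0,1}`: the sums (mod 2) of monomials of the form `x[i]`. -/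
def linearity (d : ℕ) : Set (Cube d → ZMod 2) :=
  {f | ∃ s : Finset (Fin d), ∀ x, f x = ∑ i ∈ s, x i}

end OnlineErasure

/-! The tester repeats independent blocks: query `q` uniform reserve points, then one uniformly
random combination of them, and compare its value with the same combination of the answers. A block
with an erased answer never rejects, so linear functions are always accepted. Soundness has two
ingredients. By majority decoding (`exists_additive_of_card_defect`), if `f` is `ε`-far and `ε ≤
1/2`, at least an `ε` fraction of points `z` have defect at least `1/6`. When the first reserve
point is such a `z`, about `1/12` of the coefficient vectors are violations on average
(`sum_card_violations_ge`). The oracle sees the reserve points but not the coefficients, and it can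
spoil only `t * q` of about `2 ^ q` distinct combinations, with `2 ^ q` of order `t ^ 2`. Older
erasures, erased reserve points and linear dependence are rare over all reserve tuples; the bound on
`t` puts their probability below `ε / 48`. So each block detects with probability at least `ε / 48`
whatever came before (`card_detecting_ge_of_isFar`), and order `1 / ε` blocks suffice. -/

namespace OnlineErasure

/-! ### Nonadaptive algorithms and the erasure oracle -/

namespace QueryAlg

variable {X R : Type}

/-- The nonadaptive algorithm that makes the queries in the list `l` and decides according to the
list of the answers. -/
def ofList : List X → (List (Option R) → Bool) → QueryAlg X R
  | [], D => output (D [])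
  | x :: l, D => query x fun a => ofList l fun as => D (a :: as)

theorem hasQueries_ofList (l : List X) (D : List (Option R) → Bool) :
    (ofList l D).HasQueries l := by
  induction l generalizing D with
  | nil => rfl
  | cons x l ih => exact ⟨l, rfl, fun a => ih _⟩

theorem numQueries_ofList [Fintype R] (l : List X) (D : List (Option R) → Bool) :
    (ofList l D).numQueries = l.length := by
  induction l generalizing D with
  | nil => rfl
  | cons x l ih =>
    simp only [ofList, numQueries, ih, List.length_cons]
    rw [Finset.sup_const Finset.univ_nonempty, add_comm]

end QueryAlg

section Oracle

variable {X R : Type} [DecidableEq X] {t : ℕ}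

/-- The answers of the oracle to a list of queries. -/
def answers (S : Strategy X t) (f : X → R) : List X → List X → Finset X → List (Option R)
  | [], _, _ => []
  | x :: l, hist, E =>
      (if x ∈ E then none else some (f x)) :: answers S f l (x :: hist) (E ∪ (S (x :: hist)).1)

/-- The set of the erased points after a list of queries. -/
def erased (S : Strategy X t) : List X → List X → Finset X → Finset X
  | [], _, E => E
  | x :: l, hist, E => erased S l (x :: hist) (E ∪ (S (x :: hist)).1)

variable (S : Strategy X t) (f : X → R)

theorem run_ofList (l : List X) (D : List (Option R) → Bool) (hist : List X) (E : Finset X) :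
    (QueryAlg.ofList l D).run S f hist E = D (answers S f l hist E) := by
  induction l generalizing D hist E with
  | nil => rfl
  | cons x l ih => simp only [QueryAlg.ofList, QueryAlg.run, answers, ih]

theorem length_answers (l hist : List X) (E : Finset X) :
    (answers S f l hist E).length = l.length := by
  induction l generalizing hist E with
  | nil => rfl
  | cons x l ih => simp [answers, ih]

theorem answers_append (l l' hist : List X) (E : Finset X) :
    answers S f (l ++ l') hist E =
      answers S f l hist E ++ answers S f l' (l.reverse ++ hist) (erased S l hist E) := by
  induction l generalizing hist E with
  | nil => rfl
  | cons x l ih => simp [answers, erased, ih]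

/-- Separates the erasures older than a block, fixed before its coins are drawn, from those made
during it, which are few. -/
theorem erased_eq_union (l hist : List X) (E : Finset X) :
    erased S l hist E = E ∪ erased S l hist ∅ := by
  induction l generalizing hist E with
  | nil => simp [erased]
  | cons x l ih =>
    change erased S l (x :: hist) (E ∪ (S (x :: hist)).1) =
      E ∪ erased S l (x :: hist) (∅ ∪ (S (x :: hist)).1)
    rw [ih (x :: hist) (E ∪ _), ih (x :: hist) (∅ ∪ _), Finset.empty_union, Finset.union_assoc]

theorem card_erased_le (l hist : List X) (E : Finset X) :
    (erased S l hist E).card ≤ E.card + t * l.length := by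
  induction l generalizing hist E with
  | nil => simp [erased]
  | cons x l ih =>
    simp only [erased, List.length_cons]
    have h := ih (x :: hist) (E ∪ (S (x :: hist)).1)
    have h' := Finset.card_union_le E (S (x :: hist)).1
    have h'' := (S (x :: hist)).2
    rw [mul_add]
    omega

theorem eq_map_of_answers_eq_map_some {l hist : List X} {E : Finset X} {l' : List R}
    (h : answers S f l hist E = l'.map some) : l' = l.map f := by
  induction l generalizing hist E l' with
  | nil => exact List.map_eq_nil_iff.mp h.symm
  | cons x l ih =>
    cases l' with
    | nil => simp [answers] at h
    | cons a l' =>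
      simp only [answers, List.map_cons, List.cons.injEq] at h
      obtain ⟨h1, h2⟩ := h
      rw [ih h2, List.map_cons]
      split_ifs at h1
      rw [Option.some.inj h1]

/-- None of the queries in the list is answered by the erasure symbol. -/
def Unerased (l hist : List X) (E : Finset X) : Prop :=
  answers S f l hist E = (l.map f).map some

theorem unerased_cons {x : X} {l hist : List X} {E : Finset X} :
    Unerased S f (x :: l) hist E ↔
      x ∉ E ∧ Unerased S f l (x :: hist) (E ∪ (S (x :: hist)).1) := by
  simp [Unerased, answers]

theorem unerased_append_singleton {x : X} {l hist : List X} {E : Finset X} :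
    Unerased S f (l ++ [x]) hist E ↔
      Unerased S f l hist E ∧ x ∉ erased S l hist E := by
  induction l generalizing hist E with
  | nil => simp [Unerased, answers, erased]
  | cons z l ih => simp only [List.cons_append, unerased_cons, ih, erased, and_assoc]

end Oracle

/-! ### Blocks of the tester and completeness -/

section Block

variable {V : Type} [AddCommGroup V] [Module (ZMod 2) V]

/-- The linear combination of the vectors `x i` with the coefficients `s i`. -/
def comb {q : ℕ} (x : Fin q → V) (s : Fin q → ZMod 2) : V := ∑ i, s i • x i

/-- The coins of one block of the tester: the reserve points, and the coefficients of the linear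
combination of these points that is queried last. -/
abbrev Block (V : Type) (q : ℕ) : Type := (Fin q → V) × (Fin q → ZMod 2)

/-- The queries made in a block. -/
def Block.queries {q : ℕ} (b : Block V q) : List V := List.ofFn b.1 ++ [comb b.1 b.2]

/-- The answers in a block contradict linearity. -/
def Block.Detects {q : ℕ} (b : Block V q) (as : List (Option (ZMod 2))) : Prop :=
  ∃ (v : Fin q → ZMod 2) (w : ZMod 2),
    as = (List.ofFn v ++ [w]).map some ∧ w ≠ ∑ i, b.2 i * v i

open Classical in
/-- The decision of the tester, given the coins and the answers. -/
noncomputable def accepts {q : ℕ} : List (Block V q) → List (Option (ZMod 2)) → Bool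
  | [], _ => true
  | b :: bs, as => !decide (b.Detects (as.take (q + 1))) && accepts bs (as.drop (q + 1))

/-- The tester for given coins. -/
noncomputable def blockAlg {q : ℕ} (bs : List (Block V q)) : QueryAlg V (ZMod 2) :=
  QueryAlg.ofList (bs.flatMap Block.queries) (accepts bs)

theorem Block.length_queries {q : ℕ} (b : Block V q) : b.queries.length = q + 1 := by
  simp [Block.queries]

theorem numQueries_blockAlg {q : ℕ} (bs : List (Block V q)) :
    (blockAlg bs).numQueries = bs.length * (q + 1) := by
  rw [blockAlg, QueryAlg.numQueries_ofList]
  simp [List.length_flatMap, Block.length_queries]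

variable [DecidableEq V] {t : ℕ} (S : Strategy V t) (f : V → ZMod 2)

/-- Later blocks face the same situation with a longer history and a larger erased set; this drives
the induction over blocks. -/
theorem accepts_cons {q : ℕ} (b : Block V q) (bs : List (Block V q)) (hist : List V)
    (E : Finset V) :
    accepts (b :: bs) (answers S f ((b :: bs).flatMap Block.queries) hist E) = true ↔
      ¬ b.Detects (answers S f b.queries hist E) ∧
      accepts bs (answers S f (bs.flatMap Block.queries) (b.queries.reverse ++ hist)
        (erased S b.queries hist E)) = true := by
  have h : (answers S f b.queries hist E).length = q + 1 := by
    rw [length_answers, Block.length_queries]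
  rw [List.flatMap_cons, answers_append, accepts, List.take_left' h, List.drop_left' h]
  simp

theorem Block.detects_iff {q : ℕ} (b : Block V q) (hist : List V) (E : Finset V) :
    b.Detects (answers S f b.queries hist E) ↔
      Unerased S f b.queries hist E ∧ f (comb b.1 b.2) ≠ ∑ i, b.2 i * f (b.1 i) := by
  constructor
  · rintro ⟨v, w, h, hne⟩
    have h' := eq_map_of_answers_eq_map_some S f h
    refine ⟨by rw [Unerased, h, h'], ?_⟩
    rw [Block.queries, List.map_append, List.map_ofFn] at h'
    obtain ⟨h1, h2⟩ := List.append_inj' h' (by simp)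
    rw [List.ofFn_inj] at h1
    simp only [List.map_cons, List.map_nil, List.cons.injEq, and_true] at h2
    rw [← h2]
    simpa [h1] using hne
  · rintro ⟨h, hne⟩
    refine ⟨f ∘ b.1, f (comb b.1 b.2), ?_, hne⟩
    rw [Unerased] at h
    rw [h, Block.queries, List.map_append, List.map_ofFn]
    rfl

theorem accepts_of_additive {q : ℕ} (hf : ∀ x y, f (x + y) = f x + f y) (bs : List (Block V q))
    (hist : List V) (E : Finset V) :
    accepts bs (answers S f (bs.flatMap Block.queries) hist E) = true := by
  induction bs generalizing hist E with
  | nil => rfl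
  | cons b bs ih =>
    rw [accepts_cons]
    refine ⟨?_, ih _ _⟩
    rw [Block.detects_iff]
    rintro ⟨-, h⟩
    apply h
    -- Over `ZMod 2` an additive map is automatically linear.
    let F : V →+ ZMod 2 := AddMonoidHom.mk' f hf
    have hF : ∀ (c : ZMod 2) (x : V), F (c • x) = c * F x := fun c x => ZMod.map_smul F c x
    change F (comb b.1 b.2) = _
    rw [comb, map_sum]
    exact Finset.sum_congr rfl fun i _ => hF _ _

end Block

/-! ### Counting the coins with which one block detects nonlinearity -/

section Counting

variable {V : Type} [AddCommGroup V] [Module (ZMod 2) V]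

theorem comb_cons {q : ℕ} (z : V) (x : Fin q → V) (b : ZMod 2) (s : Fin q → ZMod 2) :
    comb (Fin.cons z x : Fin (q + 1) → V) (Fin.cons b s : Fin (q + 1) → ZMod 2) =
      b • z + comb x s := by
  simp [comb, Fin.sum_univ_succ]

theorem comb_sub {q : ℕ} (x : Fin q → V) (s s' : Fin q → ZMod 2) :
    comb x (s - s') = comb x s - comb x s' := by
  simp [comb, sub_smul]

theorem zmod_two_eq_one_of_ne_zero {a : ZMod 2} (h : a ≠ 0) : a = 1 := by
  revert h; revert a; decide

theorem sum_fin_succ_fun {A : Type} [Fintype A] {M : Type} [AddCommMonoid M] {q : ℕ}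
    (h : (Fin (q + 1) → A) → M) :
    ∑ x, h x = ∑ z, ∑ x : Fin q → A, h (Fin.cons z x) := by
  rw [← Fintype.sum_prod_type']
  exact (Fintype.sum_equiv (Fin.consEquiv fun _ => A) _ _ fun _ => rfl).symm

variable [Fintype V] [DecidableEq V]

/-- A linear combination of uniform independent vectors with nonzero coefficients is uniform. -/
theorem card_mul_card_comb_mem {q : ℕ} {s : Fin q → ZMod 2} (hs : s ≠ 0) (A : Finset V) :
    Fintype.card V * (Finset.univ.filter fun x : Fin q → V => comb x s ∈ A).card =
      A.card * Fintype.card V ^ q := by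
  obtain ⟨i, hi⟩ := Function.ne_iff.mp hs
  have hi := zmod_two_eq_one_of_ne_zero hi
  -- Since `s i = 1`, translating `x i` by `v` permutes the tuples and translates the combination by
  -- `v`. Summing over `v` then makes the combination sweep all of `V`.
  have key : ∀ v : V, (Finset.univ.filter fun x : Fin q → V => comb x s ∈ A).card =
      ∑ x : Fin q → V, if comb x s + v ∈ A then 1 else 0 := by
    intro v
    rw [Finset.card_filter]
    refine (Fintype.sum_equiv (Equiv.addRight (Pi.single i v)) _ _ fun x => ?_).symm
    have : comb (x + Pi.single i v) s = comb x s + v := by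
      simp only [comb, Pi.add_apply, smul_add, Finset.sum_add_distrib]
      congr 1
      rw [Finset.sum_eq_single i]
      · simp [hi]
      · intro j _ hj; simp [hj]
      · simp
    simp only [Equiv.coe_addRight, this]
  have h2 : Fintype.card V * (Finset.univ.filter fun x : Fin q → V => comb x s ∈ A).card =
      ∑ v : V, (Finset.univ.filter fun x : Fin q → V => comb x s ∈ A).card := by simp
  rw [h2, Finset.sum_congr rfl fun v _ => key v, Finset.sum_comm]
  have h3 : ∀ x : Fin q → V, (∑ v : V, if comb x s + v ∈ A then 1 else 0) = A.card := by
    intro x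
    refine (Fintype.sum_equiv (Equiv.addLeft (comb x s)) _ (fun v => if v ∈ A then 1 else 0)
      fun v => rfl).trans ?_
    simp
  simp [h3, mul_comm]

/-- Uniform independent vectors are rarely linearly dependent. -/
theorem card_mul_card_not_injective_comb_le (q : ℕ) [DecidablePred fun x : Fin q → V =>
      ¬ Function.Injective (comb x)] :
    Fintype.card V * (Finset.univ.filter fun x : Fin q → V =>
      ¬ Function.Injective (comb x)).card ≤ 2 ^ q * Fintype.card V ^ q := by
  -- A collision of two combinations gives a nonzero `s` with combination zero; a union bound over
  -- `s` finishes.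
  have hsub : (Finset.univ.filter fun x : Fin q → V => ¬ Function.Injective (comb x)) ⊆
      (Finset.univ.filter fun s : Fin q → ZMod 2 => s ≠ 0).biUnion fun s =>
        Finset.univ.filter fun x : Fin q → V => comb x s ∈ ({0} : Finset V) := by
    intro x hx
    simp only [Finset.mem_filter, Finset.mem_univ, true_and, Function.Injective, not_forall] at hx
    obtain ⟨s, s', h, hne⟩ := hx
    simp only [Finset.mem_biUnion, Finset.mem_filter, Finset.mem_univ, true_and,
      Finset.mem_singleton]
    exact ⟨s - s', sub_ne_zero.mpr hne, by rw [comb_sub, h, sub_self]⟩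
  calc _ ≤ Fintype.card V * ∑ s ∈ Finset.univ.filter (fun s : Fin q → ZMod 2 => s ≠ 0),
        (Finset.univ.filter fun x : Fin q → V => comb x s ∈ ({0} : Finset V)).card := by
        gcongr
        exact (Finset.card_le_card hsub).trans Finset.card_biUnion_le
    _ = ∑ s ∈ Finset.univ.filter (fun s : Fin q → ZMod 2 => s ≠ 0), Fintype.card V ^ q := by
        rw [Finset.mul_sum]
        refine Finset.sum_congr rfl fun s hs => ?_
        rw [card_mul_card_comb_mem (by simpa using hs)]
        simp
    _ ≤ ∑ s : Fin q → ZMod 2, Fintype.card V ^ q :=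
        Finset.sum_le_sum_of_subset (Finset.filter_subset _ _)
    _ = _ := by simp

/-- The pairs `(s, x)` with `s ≠ 0` whose linear combination lies in a given set are rare. -/
theorem card_mul_sum_card_comb_mem_le (q : ℕ) (A : Finset V) :
    Fintype.card V * ∑ x : Fin q → V, (Finset.univ.filter fun s : Fin q → ZMod 2 =>
      s ≠ 0 ∧ comb x s ∈ A).card ≤ 2 ^ q * (A.card * Fintype.card V ^ q) := by
  simp only [Finset.card_filter]
  rw [Finset.sum_comm, Finset.mul_sum]
  calc _ ≤ ∑ s : Fin q → ZMod 2, A.card * Fintype.card V ^ q := by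
        refine Finset.sum_le_sum fun s _ => ?_
        by_cases hs : s = 0
        · simp [hs]
        · rw [← card_mul_card_comb_mem hs, Finset.card_filter]
          simp [hs]
    _ = _ := by simp

omit [AddCommGroup V] [Module (ZMod 2) V] in
/-- Uniform independent queries are rarely erased. -/
theorem card_mul_card_not_unerased_le {t : ℕ} (S : Strategy V t) (f : V → ZMod 2) (B q : ℕ)
    (hist : List V) (E : Finset V) (hE : E.card + t * q ≤ B)
    [∀ q hist E, DecidablePred fun x : Fin q → V => ¬ Unerased S f (List.ofFn x) hist E] :
    Fintype.card V * (Finset.univ.filter fun x : Fin q → V =>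
      ¬ Unerased S f (List.ofFn x) hist E).card ≤ q * B * Fintype.card V ^ q := by
  induction q generalizing hist E with
  | zero => simp [Unerased, answers]
  | succ q ih =>
    rw [Finset.card_filter, sum_fin_succ_fun]
    -- Either the first query hits `E`, or the failure occurs among the remaining queries. `B`
    -- bounds the erased set throughout, so each query costs at most `B / |V|`.
    have hstep : ∀ z : V, (∑ x : Fin q → V, if ¬ Unerased S f
          (List.ofFn (Fin.cons z x : Fin (q + 1) → V)) hist E then 1 else 0) ≤
        (if z ∈ E then Fintype.card V ^ q else 0) + (Finset.univ.filter fun x : Fin q → V =>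
          ¬ Unerased S f (List.ofFn x) (z :: hist) (E ∪ (S (z :: hist)).1)).card := by
      intro z
      by_cases hz : z ∈ E
      · rw [if_pos hz]
        refine le_add_right ?_
        rw [← Finset.card_filter]
        exact (Finset.card_le_univ _).trans (by simp)
      · rw [Finset.card_filter]
        simp [List.ofFn_succ, unerased_cons, hz]
    have hrec : ∀ z : V, Fintype.card V * (Finset.univ.filter fun x : Fin q → V =>
        ¬ Unerased S f (List.ofFn x) (z :: hist) (E ∪ (S (z :: hist)).1)).card ≤
        q * B * Fintype.card V ^ q := by
      intro z
      apply ih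
      have h' := Finset.card_union_le E (S (z :: hist)).1
      have h'' := (S (z :: hist)).2
      rw [mul_add] at hE
      omega
    calc _ ≤ Fintype.card V * ∑ z : V, ((if z ∈ E then Fintype.card V ^ q else 0) +
          (Finset.univ.filter fun x : Fin q → V =>
          ¬ Unerased S f (List.ofFn x) (z :: hist) (E ∪ (S (z :: hist)).1)).card) := by
          gcongr with z; exact hstep z
      _ = Fintype.card V * (E.card * Fintype.card V ^ q) + ∑ z : V, Fintype.card V *
          (Finset.univ.filter fun x : Fin q → V =>
          ¬ Unerased S f (List.ofFn x) (z :: hist) (E ∪ (S (z :: hist)).1)).card := by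
          rw [Finset.sum_add_distrib, mul_add, ← Finset.mul_sum]
          simp
      _ ≤ Fintype.card V * (B * Fintype.card V ^ q) +
          ∑ z : V, q * B * Fintype.card V ^ q := by
          refine Nat.add_le_add ?_ (Finset.sum_le_sum fun z _ => hrec z)
          gcongr
          omega
      _ = _ := by
          simp only [Finset.sum_const, Finset.card_univ, smul_eq_mul]
          ring

/-- The points at which `f` violates additivity together with `z`. -/
def defect (f : V → ZMod 2) (z : V) : Finset V :=
  Finset.univ.filter fun y => f (y + z) ≠ f y + f z

/-- The coefficients for which the values of `f` at the reserve points and at their linear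
combination contradict linearity. -/
def violations (f : V → ZMod 2) {q : ℕ} (x : Fin q → V) : Finset (Fin q → ZMod 2) :=
  Finset.univ.filter fun s => f (comb x s) ≠ ∑ i, s i * f (x i)

/-- If `comb x s` lies in the defect of `z`, the coefficients `(0, s)` and `(1, s)` cannot both be
consistent: together they would give additivity at `comb x s` and `z`. For each of the `2 ^ r - 1`
nonzero `s` the point `comb x s` is uniform. -/
theorem sum_card_violations_ge (f : V → ZMod 2) (r : ℕ) (z : V) :
    (2 ^ r - 1) * ((defect f z).card * Fintype.card V ^ r) ≤ Fintype.card V *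
      ∑ x : Fin r → V, (violations f (Fin.cons z x : Fin (r + 1) → V)).card := by
  have h1 : ∀ x : Fin r → V, (∑ s : Fin r → ZMod 2, if comb x s ∈ defect f z then 1 else 0) ≤
      (violations f (Fin.cons z x : Fin (r + 1) → V)).card := by
    intro x
    rw [violations, Finset.card_filter, sum_fin_succ_fun, Finset.sum_comm]
    refine Finset.sum_le_sum fun s _ => ?_
    split_ifs with h
    · rw [defect, Finset.mem_filter] at h
      have huniv : (Finset.univ : Finset (ZMod 2)) = {0, 1} := by decide
      rw [huniv, Finset.sum_pair (by decide)]
      simp only [comb_cons, Fin.sum_univ_succ, Fin.cons_zero, Fin.cons_succ, zero_smul, one_smul,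
        zero_mul, zero_add, one_mul]
      by_contra hcon
      have h0 : f (comb x s) = ∑ i, s i * f (x i) := by
        by_contra h0; rw [if_pos h0] at hcon; omega
      have h1 : f (z + comb x s) = f z + ∑ i, s i * f (x i) := by
        by_contra h1; rw [if_pos h1] at hcon; omega
      apply h.2
      rw [add_comm, h1, h0, add_comm]
    · exact Nat.zero_le _
  calc _ = ∑ s ∈ Finset.univ.filter (fun s : Fin r → ZMod 2 => s ≠ 0),
        (defect f z).card * Fintype.card V ^ r := by
        rw [Finset.sum_const, Finset.filter_ne', Finset.card_erase_of_mem (Finset.mem_univ _)]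
        simp
    _ = ∑ s ∈ Finset.univ.filter (fun s : Fin r → ZMod 2 => s ≠ 0), Fintype.card V *
        ∑ x : Fin r → V, if comb x s ∈ defect f z then 1 else 0 := by
        refine Finset.sum_congr rfl fun s hs => ?_
        rw [← card_mul_card_comb_mem (by simpa using hs), Finset.card_filter]
    _ ≤ ∑ s : Fin r → ZMod 2, Fintype.card V *
        ∑ x : Fin r → V, if comb x s ∈ defect f z then 1 else 0 :=
        Finset.sum_le_sum_of_subset (Finset.filter_subset _ _)
    _ = Fintype.card V * ∑ x : Fin r → V, ∑ s : Fin r → ZMod 2,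
        if comb x s ∈ defect f z then 1 else 0 := by
        rw [← Finset.mul_sum, Finset.sum_comm]
    _ ≤ _ := by gcongr with x; exact h1 x

open Classical in
/-- The coins of a block that detect nonlinearity. -/
noncomputable def detecting {t : ℕ} (S : Strategy V t) (f : V → ZMod 2) (q : ℕ) (hist : List V)
    (E : Finset V) : Finset (Block V q) :=
  Finset.univ.filter fun b => b.Detects (answers S f b.queries hist E)

-- A violating `s` fails to detect only if a reserve point or the combination is erased. The
-- parenthesized errors are to be summed over all `x`. The final `t * q + 1` bounds the combinations
-- erased during the block, plus `s = 0`, and holds for each `x` separately.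
open Classical in
theorem card_violations_le {t : ℕ} (S : Strategy V t) (f : V → ZMod 2) {q : ℕ} (hist : List V)
    (E : Finset V) (x : Fin q → V) :
    (violations f x).card ≤
      (∑ s : Fin q → ZMod 2, if (x, s) ∈ detecting S f q hist E then 1 else 0) +
      (2 ^ q * (if ¬ Unerased S f (List.ofFn x) hist E then 1 else 0) +
       2 ^ q * (if ¬ Function.Injective (comb x) then 1 else 0) +
       (Finset.univ.filter fun s : Fin q → ZMod 2 => s ≠ 0 ∧ comb x s ∈ E).card) +
      (t * q + 1) := by
  have htriv : (violations f x).card ≤ 2 ^ q := (Finset.card_le_univ _).trans (by simp)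
  by_cases hU : Unerased S f (List.ofFn x) hist E
  swap
  · rw [if_pos hU]; omega
  by_cases hI : Function.Injective (comb x)
  swap
  · rw [if_pos hI]; omega
  rw [← Finset.card_filter]
  have hsub : violations f x ⊆
      ((Finset.univ.filter fun s => (x, s) ∈ detecting S f q hist E) ∪
      (Finset.univ.filter fun s : Fin q → ZMod 2 => s ≠ 0 ∧ comb x s ∈ E)) ∪
      ((Finset.univ.filter fun s => comb x s ∈ erased S (List.ofFn x) hist ∅) ∪ {0}) := by
    intro s hs
    simp only [violations, Finset.mem_filter, Finset.mem_univ, true_and] at hs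
    simp only [Finset.mem_union, Finset.mem_filter, Finset.mem_univ, true_and, detecting,
      Finset.mem_singleton, Block.detects_iff]
    by_cases h0 : s = 0
    · exact Or.inr (Or.inr h0)
    by_cases h1 : comb x s ∈ erased S (List.ofFn x) hist ∅
    · exact Or.inr (Or.inl h1)
    by_cases h2 : comb x s ∈ E
    · exact Or.inl (Or.inr ⟨h0, h2⟩)
    refine Or.inl (Or.inl ⟨?_, hs⟩)
    rw [Block.queries, unerased_append_singleton, erased_eq_union]
    exact ⟨hU, by simp [h1, h2]⟩
  -- Injectivity lets each point erased during the block spoil only one `s`.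
  have hnew : (Finset.univ.filter fun s => comb x s ∈ erased S (List.ofFn x) hist ∅).card ≤
      t * q := by
    refine (Finset.card_le_card_of_injOn (comb x) (fun s hs => by simpa using hs)
      hI.injOn).trans ((card_erased_le S (List.ofFn x) hist ∅).trans (by simp))
  have hc := (Finset.card_le_card hsub).trans (Finset.card_union_le _ _)
  have hc1 := Finset.card_union_le
    (Finset.univ.filter fun s => (x, s) ∈ detecting S f q hist E)
    (Finset.univ.filter fun s : Fin q → ZMod 2 => s ≠ 0 ∧ comb x s ∈ E)
  have hc2 := Finset.card_union_le
    (Finset.univ.filter fun s => comb x s ∈ erased S (List.ofFn x) hist ∅) {0}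
  rw [Finset.card_singleton] at hc2
  omega

/-- The number of the coins of a block that detect nonlinearity, in terms of the points `z ∈ Z`
that have a large defect. -/
theorem card_detecting_ge {t : ℕ} (S : Strategy V t) (f : V → ZMod 2) (r B : ℕ) (hist : List V)
    (E : Finset V) (hE : E.card + t * (r + 1) ≤ B) (Z : Finset V)
    (hZ : ∀ z ∈ Z, Fintype.card V ≤ 6 * (defect f z).card) :
    (2 ^ r - 1) * (Z.card * Fintype.card V ^ (r + 1)) ≤
      6 * (Fintype.card V * (detecting S f (r + 1) hist E).card +
        2 ^ (r + 1) * (((r + 1) * B + 2 ^ (r + 1) + B) * Fintype.card V ^ (r + 1)) +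
        (t * (r + 1) + 1) * (Z.card * Fintype.card V ^ (r + 1))) := by
  classical
  set N := Fintype.card V with hN
  set q := r + 1 with hq
  let a : (Fin q → V) → ℕ := fun x =>
    ∑ s : Fin q → ZMod 2, if (x, s) ∈ detecting S f q hist E then 1 else 0
  let e : (Fin q → V) → ℕ := fun x =>
    2 ^ q * (if ¬ Unerased S f (List.ofFn x) hist E then 1 else 0) +
    2 ^ q * (if ¬ Function.Injective (comb x) then 1 else 0) +
    (Finset.univ.filter fun s : Fin q → ZMod 2 => s ≠ 0 ∧ comb x s ∈ E).card
  have ha : ∑ x, a x = (detecting S f q hist E).card := by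
    simp only [a]
    rw [← Fintype.sum_prod_type']
    simp
  have he : N * ∑ x, e x ≤ 2 ^ q * ((q * B + 2 ^ q + B) * N ^ q) := by
    simp only [e, Finset.sum_add_distrib, ← Finset.mul_sum, ← Finset.card_filter]
    have h1 := card_mul_card_not_unerased_le S f B q hist E hE
    have h2 := card_mul_card_not_injective_comb_le (V := V) q
    have h3 := card_mul_sum_card_comb_mem_le q E
    have h4 : E.card ≤ B := by omega
    rw [← hN] at h1 h2 h3
    calc _ = 2 ^ q * (N * (Finset.univ.filter fun x : Fin q → V =>
            ¬ Unerased S f (List.ofFn x) hist E).card) +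
          2 ^ q * (N * (Finset.univ.filter fun x : Fin q → V =>
            ¬ Function.Injective (comb x)).card) +
          N * ∑ x : Fin q → V, (Finset.univ.filter fun s : Fin q → ZMod 2 =>
            s ≠ 0 ∧ comb x s ∈ E).card := by ring
      _ ≤ 2 ^ q * (q * B * N ^ q) + 2 ^ q * (2 ^ q * N ^ q) + 2 ^ q * (B * N ^ q) := by
          exact Nat.add_le_add (Nat.add_le_add (Nat.mul_le_mul_left _ h1)
            (Nat.mul_le_mul_left _ h2)) (h3.trans (by gcongr))
      _ = _ := by ring
  -- Only `a` and `e` are extended from `z ∈ Z` to all first points. The term `t * q + 1` stays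
  -- weighted by `Z.card`: it is small against `2 ^ q`, but need not be small against `ε * 2 ^ q`.
  have hsum : ∀ h : (Fin q → V) → ℕ, ∑ z ∈ Z, ∑ x : Fin r → V, h (Fin.cons z x) ≤ ∑ x, h x := by
    intro h
    rw [sum_fin_succ_fun h]
    exact Finset.sum_le_sum_of_subset (Finset.subset_univ Z)
  have hmain : ∑ z ∈ Z, ∑ x : Fin r → V, (violations f (Fin.cons z x : Fin q → V)).card ≤
      (detecting S f q hist E).card + ∑ x, e x + (t * q + 1) * (Z.card * N ^ r) := by
    calc _ ≤ ∑ z ∈ Z, ∑ x : Fin r → V, (a (Fin.cons z x : Fin q → V) +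
          e (Fin.cons z x : Fin q → V) + (t * q + 1)) := by
          gcongr with z _ x
          exact card_violations_le S f hist E _
      _ ≤ _ := by
          simp only [Finset.sum_add_distrib]
          rw [← ha]
          refine Nat.add_le_add (Nat.add_le_add (hsum a) (hsum e)) (le_of_eq ?_)
          simp [← hN]
          ring
  calc _ = ∑ z ∈ Z, (2 ^ r - 1) * (N * N ^ r) := by
        rw [Finset.sum_const, smul_eq_mul, hq, pow_succ]; ring
    _ ≤ ∑ z ∈ Z, 6 * ((2 ^ r - 1) * ((defect f z).card * N ^ r)) := by
        refine Finset.sum_le_sum fun z hz => ?_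
        calc _ ≤ (2 ^ r - 1) * ((6 * (defect f z).card) * N ^ r) := by
              gcongr; exact hZ z hz
          _ = _ := by ring
    _ ≤ ∑ z ∈ Z, 6 * (N * ∑ x : Fin r → V, (violations f (Fin.cons z x : Fin q → V)).card) := by
        exact Finset.sum_le_sum fun z _ =>
          Nat.mul_le_mul_left _ (sum_card_violations_ge f r z)
    _ = 6 * (N * ∑ z ∈ Z, ∑ x : Fin r → V, (violations f (Fin.cons z x : Fin q → V)).card) := by
        rw [← Finset.mul_sum, ← Finset.mul_sum]
    _ ≤ 6 * (N * ((detecting S f q hist E).card + ∑ x, e x +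
          (t * q + 1) * (Z.card * N ^ r))) := by gcongr
    _ = 6 * (N * (detecting S f q hist E).card + N * ∑ x, e x +
          (t * q + 1) * (Z.card * N ^ q)) := by
        have : N ^ q = N ^ r * N := pow_succ N r
        rw [this]; ring
    _ ≤ _ := by gcongr

end Counting

/-! ### Majority decoding -/

section Structure

variable {V : Type} [Fintype V] [DecidableEq V]

/-- Three small sets do not cover the space. -/
theorem exists_not_mem_of_card_lt {A B C : Finset V}
    (h : A.card + B.card + C.card < Fintype.card V) : ∃ y, y ∉ A ∧ y ∉ B ∧ y ∉ C := by
  by_contra! hcon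
  have hsub : (Finset.univ : Finset V) ⊆ A ∪ B ∪ C := by
    intro y _
    have := hcon y
    simp only [Finset.mem_union]
    tauto
  have h1 := Finset.card_le_card hsub
  have h2 := Finset.card_union_le (A ∪ B) C
  have h3 := Finset.card_union_le A B
  rw [Finset.card_univ] at h1
  omega

variable [AddCommGroup V]

/-- The points at which adding `u` does not change the value of `f` by `c`. -/
def exceptions (f : V → ZMod 2) (u : V) (c : ZMod 2) : Finset V :=
  Finset.univ.filter fun y => f (y + u) ≠ f y + c

/-- If the set of the points with a large defect is less than half of the space, then it contains
all the points at which `f` differs from some additive function. -/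
theorem exists_additive_of_card_defect (f : V → ZMod 2) (Z : Finset V)
    (hZ : 2 * Z.card < Fintype.card V)
    (hf : ∀ z, z ∉ Z → 6 * (defect f z).card < Fintype.card V) :
    ∃ g : V → ZMod 2, (∀ x y, g (x + y) = g x + g y) ∧ ∀ z, z ∉ Z → g z = f z := by
  -- As `Z` is less than half of the space, `u = z + (u - z)` with both summands outside `Z`. Adding
  -- them one after the other fails only on two sets, each smaller than a sixth of the space.
  have hex : ∀ u, ∃ c, 3 * (exceptions f u c).card < Fintype.card V := by
    intro u
    obtain ⟨z, hz, hz', -⟩ := exists_not_mem_of_card_lt (A := Z)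
      (B := Z.map (Equiv.subLeft u).toEmbedding) (C := ∅) (by
        rw [Finset.card_map, Finset.card_empty]; omega)
    have hw : u - z ∉ Z := by
      intro h
      apply hz'
      rw [Finset.mem_map_equiv]
      simpa [neg_add_eq_sub] using h
    refine ⟨f z + f (u - z), ?_⟩
    have hsub : exceptions f u (f z + f (u - z)) ⊆
        defect f z ∪ (defect f (u - z)).map (Equiv.subRight z).toEmbedding := by
      intro y hy
      simp only [exceptions, Finset.mem_filter, Finset.mem_univ, true_and] at hy
      simp only [defect, Finset.mem_union, Finset.mem_map_equiv, Finset.mem_filter,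
        Finset.mem_univ, true_and, Equiv.subRight_symm_apply]
      by_contra! hcon
      apply hy
      have h : y + z + (u - z) = y + u := by abel
      rw [h] at hcon
      rw [hcon.2, hcon.1, add_assoc]
    have h1 := (Finset.card_le_card hsub).trans (Finset.card_union_le _ _)
    rw [Finset.card_map] at h1
    have h2 := hf z hz
    have h3 := hf _ hw
    omega
  choose g hg using hex
  refine ⟨g, fun u w => ?_, fun z hz => ?_⟩
  -- Three exception sets below a third leave a common `y` that compares `g u + g w` with `g (u +
  -- w)`.
  · obtain ⟨y, h1, h2, h3⟩ := exists_not_mem_of_card_lt (A := exceptions f u (g u))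
      (B := (exceptions f w (g w)).map (Equiv.subRight u).toEmbedding)
      (C := exceptions f (u + w) (g (u + w))) (by
        rw [Finset.card_map]
        have := hg u
        have := hg w
        have := hg (u + w)
        omega)
    simp only [exceptions, Finset.mem_map_equiv, Finset.mem_filter, Finset.mem_univ, true_and,
      Equiv.subRight_symm_apply, not_not] at h1 h2 h3
    rw [add_assoc, h3, h1, add_assoc] at h2
    exact add_left_cancel h2
  · obtain ⟨y, h1, h2, -⟩ := exists_not_mem_of_card_lt (A := exceptions f z (g z))
      (B := defect f z) (C := ∅) (by
        have := hg z
        have := hf z hz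
        rw [Finset.card_empty]
        omega)
    simp only [exceptions, defect, Finset.mem_filter, Finset.mem_univ, true_and, not_not]
      at h1 h2
    rw [h1] at h2
    exact add_left_cancel h2

end Structure

/-! ### Linear functions on the cube and distance to linearity -/

theorem add_of_mem_linearity {d : ℕ} {f : Cube d → ZMod 2} (hf : f ∈ linearity d) (x y : Cube d) :
    f (x + y) = f x + f y := by
  obtain ⟨s, hs⟩ := hf
  simp [hs, Finset.sum_add_distrib]

theorem mem_linearity_of_add {d : ℕ} {g : Cube d → ZMod 2} (hg : ∀ x y, g (x + y) = g x + g y) :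
    g ∈ linearity d := by
  let F : Cube d →+ ZMod 2 := AddMonoidHom.mk' g hg
  refine ⟨Finset.univ.filter fun i => g (Pi.single i 1) ≠ 0, fun x => ?_⟩
  have hx : x = ∑ i, x i • (Pi.single i 1 : Cube d) := by
    funext j
    simp [Finset.sum_apply, Pi.single_apply]
  have hF : ∀ (c : ZMod 2) (x : Cube d), F (c • x) = c * F x := fun c x => ZMod.map_smul F c x
  change F x = _
  conv_lhs => rw [hx]
  rw [map_sum, Finset.sum_filter]
  refine Finset.sum_congr rfl fun i _ => ?_
  rw [hF]
  change x i * g (Pi.single i 1) = _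
  split_ifs with h
  · rw [zmod_two_eq_one_of_ne_zero h, mul_one]
  · rw [not_not.mp h, mul_zero]

/-- A function that is far from linear has many points with a large defect. -/
theorem card_large_defect_ge {d : ℕ} {ε : ℝ} (hε : ε ≤ 1 / 2) {f : Cube d → ZMod 2}
    (hf : IsFar ε (linearity d) f) :
    ε * (Fintype.card (Cube d) : ℝ) ≤
      ((Finset.univ.filter fun z => Fintype.card (Cube d) ≤ 6 * (defect f z).card).card : ℝ) := by
  set Z := Finset.univ.filter fun z => Fintype.card (Cube d) ≤ 6 * (defect f z).card with hZ
  by_cases h : 2 * Z.card < Fintype.card (Cube d)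
  · obtain ⟨g, hg, hgf⟩ := exists_additive_of_card_defect f Z h fun z hz => by
      simpa [hZ] using hz
    refine (hf g (mem_linearity_of_add hg)).trans ?_
    refine Nat.cast_le.mpr (Finset.card_le_card fun x hx => ?_)
    by_contra hcon
    simp only [Finset.mem_filter, Finset.mem_univ, true_and] at hx
    exact hx (hgf x hcon).symm
  · have h' : (Fintype.card (Cube d) : ℝ) ≤ 2 * Z.card := by exact_mod_cast not_lt.mp h
    have : ε * (Fintype.card (Cube d) : ℝ) ≤ 1 / 2 * (Fintype.card (Cube d) : ℝ) := by gcongr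
    linarith

/-- No function in positive dimension is more than `1 / 2`-far from linear. -/
theorem not_isFar_linearity {d : ℕ} (hd : 0 < d) {ε : ℝ} (hε : 1 / 2 < ε)
    (f : Cube d → ZMod 2) : ¬ IsFar ε (linearity d) f := by
  intro hf
  have hℓ : ∀ a : Cube d, (fun x : Cube d => ∑ i, a i * x i) ∈ linearity d := fun a =>
    mem_linearity_of_add fun x y => by simp [mul_add, Finset.sum_add_distrib]
  set N := Fintype.card (Cube d) with hN
  have hNd : N = 2 * 2 ^ (d - 1) := by
    rw [hN, ← pow_succ', Nat.sub_add_cancel hd]; simp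
  -- Double counting of disagreements: being more than `1/2`-far forces at least `N / 2 + 1` of them
  -- for every linear function, by integrality.
  have hlow : ∀ a : Cube d,
      2 ^ (d - 1) + 1 ≤ (Finset.univ.filter fun x : Cube d => f x ≠ ∑ i, a i * x i).card := by
    intro a
    have h := hf _ (hℓ a)
    have hpos : (0 : ℝ) < 2 ^ (d - 1) := by positivity
    have : ((2 ^ (d - 1) : ℕ) : ℝ) <
        ((Finset.univ.filter fun x : Cube d => f x ≠ ∑ i, a i * x i).card : ℝ) := by
      refine lt_of_lt_of_le ?_ h
      rw [← hN, hNd]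
      push_cast
      nlinarith
    exact_mod_cast this
  have hup : ∀ x : Cube d, x ≠ 0 →
      (Finset.univ.filter fun a : Cube d => f x ≠ ∑ i, a i * x i).card ≤ 2 ^ (d - 1) := by
    intro x hx
    -- The roles are exchanged: `x ≠ 0` supplies the coefficients and `a` the vectors, so exactly
    -- half of the `a` disagree at `x`.
    have h := card_mul_card_comb_mem (V := ZMod 2) (q := d) hx {f x + 1}
    have h2 : (2 : ℕ) ^ d = 2 * 2 ^ (d - 1) := by rw [← pow_succ', Nat.sub_add_cancel hd]
    simp only [ZMod.card, Finset.card_singleton, one_mul, h2] at h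
    have h := Nat.eq_of_mul_eq_mul_left two_pos h
    rw [← h]
    refine Finset.card_le_card fun a ha => ?_
    simp only [Finset.mem_filter, Finset.mem_univ, true_and, Finset.mem_singleton] at ha ⊢
    have hc : comb a x = ∑ i, a i * x i := Finset.sum_congr rfl fun i _ => mul_comm _ _
    rw [hc]
    revert ha
    generalize f x = u
    generalize ∑ i, a i * x i = v
    revert u v
    decide
  have hswap : ∑ a : Cube d, (Finset.univ.filter fun x : Cube d => f x ≠ ∑ i, a i * x i).card =
      ∑ x : Cube d, (Finset.univ.filter fun a : Cube d => f x ≠ ∑ i, a i * x i).card := by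
    simp only [Finset.card_filter]
    exact Finset.sum_comm
  have h1 : N * (2 ^ (d - 1) + 1) ≤
      ∑ a : Cube d, (Finset.univ.filter fun x : Cube d => f x ≠ ∑ i, a i * x i).card := by
    refine le_trans (le_of_eq ?_) (Finset.sum_le_sum fun a _ => hlow a)
    rw [Finset.sum_const, Finset.card_univ, smul_eq_mul]
  -- At `x = 0` all linear functions vanish, so all of them may disagree there; even so the total
  -- stays below `N * (N / 2 + 1)`.
  have h2 : ∑ x : Cube d, (Finset.univ.filter fun a : Cube d => f x ≠ ∑ i, a i * x i).card ≤
      N + (N - 1) * 2 ^ (d - 1) := by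
    rw [← Finset.add_sum_erase _ _ (Finset.mem_univ 0)]
    refine Nat.add_le_add (Finset.card_le_univ _) ?_
    refine (Finset.sum_le_sum fun x hx => hup x (Finset.ne_of_mem_erase hx)).trans ?_
    rw [Finset.sum_const, Finset.card_erase_of_mem (Finset.mem_univ _), smul_eq_mul,
      Finset.card_univ]
  have h3 : (N - 1) * 2 ^ (d - 1) < N * 2 ^ (d - 1) := by
    have : 0 < 2 ^ (d - 1) := by positivity
    gcongr
    omega
  rw [mul_add, mul_one] at h1
  omega

/-! ### Independent repetition of blocks -/

section Tester

variable {V : Type} [AddCommGroup V] [Module (ZMod 2) V] [Fintype V] [DecidableEq V]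

/-- The coins of the tester: `m` independent uniform blocks. -/
noncomputable def coins (V : Type) [AddCommGroup V] [Fintype V] (q : ℕ) :
    ℕ → PMF (List (Block V q))
  | 0 => PMF.pure []
  | m + 1 => (PMF.uniformOfFintype (Block V q)).bind fun b => (coins V q m).map (b :: ·)

omit [Module (ZMod 2) V] [DecidableEq V] in
theorem length_of_mem_support_coins {q m : ℕ} {bs : List (Block V q)}
    (h : bs ∈ (coins V q m).support) : bs.length = m := by
  induction m generalizing bs with
  | zero => simp [coins] at h; simp [h]
  | succ m ih =>
    simp only [coins, PMF.mem_support_bind_iff, PMF.mem_support_map_iff] at h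
    obtain ⟨b, -, bs', h', rfl⟩ := h
    simp [ih h']

/-- The tester that consists of `m` blocks with `q` reserve points each. -/
noncomputable def blockTester (V : Type) [AddCommGroup V] [Module (ZMod 2) V] [Fintype V]
    (q m : ℕ) : RandAlg V (ZMod 2) :=
  (coins V q m).map blockAlg

omit [DecidableEq V] in
theorem isNonadaptive_blockTester (q m : ℕ) : IsNonadaptive (blockTester V q m) := by
  intro A hA
  rw [blockTester, PMF.mem_support_map_iff] at hA
  obtain ⟨bs, -, rfl⟩ := hA
  exact ⟨_, QueryAlg.hasQueries_ofList _ _⟩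

omit [DecidableEq V] in
theorem numQueries_of_mem_support_blockTester {q m : ℕ} {A : QueryAlg V (ZMod 2)}
    (hA : A ∈ (blockTester V q m).support) : A.numQueries = m * (q + 1) := by
  rw [blockTester, PMF.mem_support_map_iff] at hA
  obtain ⟨bs, hbs, rfl⟩ := hA
  rw [numQueries_blockAlg, length_of_mem_support_coins hbs]

/-- Conditioning on the oracle's coins first reduces soundness to deterministic strategies. -/
theorem outcome_eq_bind {X R : Type} [DecidableEq X] {t : ℕ} (T : RandAlg X R)
    (σ : RandStrategy X t) (f : X → R) :
    outcome T σ f = σ.bind fun S => T.map fun A => A.run S f [] ∅ := by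
  simp only [outcome, PMF.map, Function.comp_def]
  exact PMF.bind_comm _ _ _

theorem outcome_eq_pure {X R : Type} [DecidableEq X] {t : ℕ} {T : RandAlg X R}
    {σ : RandStrategy X t} {f : X → R}
    (h : ∀ S : Strategy X t, ∀ A ∈ T.support, A.run S f [] ∅ = true) :
    outcome T σ f true = 1 := by
  rw [PMF.apply_eq_one_iff]
  ext b
  simp only [outcome, PMF.mem_support_bind_iff, PMF.mem_support_map_iff, Set.mem_singleton_iff]
  constructor
  · rintro ⟨A, hA, S, -, rfl⟩
    exact h S A hA
  · rintro rfl
    obtain ⟨A, hA⟩ := T.support_nonempty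
    obtain ⟨S, hS⟩ := σ.support_nonempty
    exact ⟨A, hA, S, hS, h S A hA⟩

theorem le_outcome_false {X R : Type} [DecidableEq X] {t : ℕ} {T : RandAlg X R}
    {σ : RandStrategy X t} {f : X → R}
    (h : ∀ S : Strategy X t, (T.map fun A => A.run S f [] ∅) true ≤ 1 / 3) :
    2 / 3 ≤ outcome T σ f false := by
  have htrue : outcome T σ f true ≤ 1 / 3 := by
    rw [outcome_eq_bind, PMF.bind_apply]
    calc _ ≤ ∑' S, σ S * (1 / 3) := ENNReal.tsum_le_tsum fun S => by gcongr; exact h S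
      _ = 1 / 3 := by rw [ENNReal.tsum_mul_right, PMF.tsum_coe, one_mul]
  have hsum : outcome T σ f true + outcome T σ f false = 1 := by
    rw [← PMF.tsum_coe (outcome T σ f), tsum_bool, add_comm]
  have h1 : (2 / 3 : ENNReal) + 1 / 3 = 1 := by
    rw [ENNReal.div_add_div_same]
    norm_num
    exact ENNReal.div_self (by norm_num) (by norm_num)
  have h2 : (2 / 3 : ENNReal) + 1 / 3 ≤ outcome T σ f false + 1 / 3 := by
    calc _ = outcome T σ f false + outcome T σ f true := by rw [h1, ← hsum, add_comm]
      _ ≤ _ := by gcongr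
  exact ENNReal.le_of_add_le_add_right (by simp) h2

theorem outcome_blockTester_true {t : ℕ} (q m : ℕ) (σ : RandStrategy V t) {f : V → ZMod 2}
    (hf : ∀ x y, f (x + y) = f x + f y) : outcome (blockTester V q m) σ f true = 1 := by
  refine outcome_eq_pure fun S A hA => ?_
  rw [blockTester, PMF.mem_support_map_iff] at hA
  obtain ⟨bs, -, rfl⟩ := hA
  rw [blockAlg, run_ofList]
  exact accepts_of_additive S f hf bs _ _

/-- If every block detects nonlinearity with probability at least `1 - p`, whatever happened
before, then all the blocks accept with probability at most `p ^ m`. -/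
theorem map_accepts_coins_le {t : ℕ} (S : Strategy V t) (f : V → ZMod 2) (q B : ℕ) (p : ENNReal)
    (h : ∀ (hist : List V) (E : Finset V), E.card + t * q ≤ B →
      (((detecting S f q hist E)ᶜ.card : ENNReal) / Fintype.card (Block V q)) ≤ p)
    (m : ℕ) (hist : List V) (E : Finset V) (hE : E.card + t * (m * (q + 1)) ≤ B) :
    ((coins V q m).map fun bs =>
      accepts bs (answers S f (bs.flatMap Block.queries) hist E)) true ≤ p ^ m := by
  classical
  induction m generalizing hist E with
  | zero => rw [pow_zero]; exact PMF.coe_le_one _ _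
  | succ m ih =>
    have hstep : ∀ b : Block V q, ((coins V q m).map fun bs =>
        accepts (b :: bs) (answers S f ((b :: bs).flatMap Block.queries) hist E)) true ≤
        if b ∈ (detecting S f q hist E)ᶜ then p ^ m else 0 := by
      intro b
      by_cases hb : b.Detects (answers S f b.queries hist E)
      · have h0 : (fun bs => accepts (b :: bs)
            (answers S f ((b :: bs).flatMap Block.queries) hist E)) = fun _ => false := by
          funext bs
          rw [Bool.eq_false_iff]
          intro hcon
          exact ((accepts_cons S f b bs hist E).mp hcon).1 hb
        rw [h0]
        simp
      · have h0 : (fun bs => accepts (b :: bs)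
            (answers S f ((b :: bs).flatMap Block.queries) hist E)) = fun bs => accepts bs
            (answers S f (bs.flatMap Block.queries) (b.queries.reverse ++ hist)
              (erased S b.queries hist E)) := by
          funext bs
          rw [Bool.eq_iff_iff, accepts_cons]
          simp [hb]
        rw [h0, if_pos (by simp [detecting, hb])]
        apply ih
        have := card_erased_le S b.queries hist E
        rw [Block.length_queries] at this
        calc _ ≤ E.card + t * (q + 1) + t * (m * (q + 1)) := by gcongr
          _ = E.card + t * ((m + 1) * (q + 1)) := by ring
          _ ≤ B := hE
    rw [coins, PMF.map_bind, PMF.bind_apply]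
    simp only [PMF.map_comp, Function.comp_def, PMF.uniformOfFintype_apply, tsum_fintype]
    rw [← Finset.mul_sum]
    calc _ ≤ (Fintype.card (Block V q) : ENNReal)⁻¹ *
          ∑ b : Block V q, if b ∈ (detecting S f q hist E)ᶜ then p ^ m else 0 := by
          gcongr with b
          exact hstep b
      _ = (((detecting S f q hist E)ᶜ.card : ENNReal) / Fintype.card (Block V q)) * p ^ m := by
          rw [Finset.sum_ite_mem, Finset.univ_inter, Finset.sum_const, nsmul_eq_mul,
            ENNReal.div_eq_inv_mul, mul_assoc]
      _ ≤ p * p ^ m := by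
          gcongr
          refine h hist E (le_trans ?_ hE)
          gcongr
          nlinarith [Nat.zero_le (m * q)]
      _ = p ^ (m + 1) := by rw [pow_succ']

end Tester

/-! ### Choice of parameters and numerical estimates -/

/-- The number of the reserve points in a block, minus one. -/
def reserveSize (t : ℕ) : ℕ := 2 * Nat.log 2 t + 11

/-- The number of the blocks. -/
noncomputable def numBlocks (ε : ℝ) : ℕ := ⌈96 / ε⌉₊

theorem numBlocks_le {ε : ℝ} (hε : 0 < ε) (hε' : ε ≤ 1) : (numBlocks ε : ℝ) ≤ 97 / ε := by
  have h := Nat.ceil_lt_add_one (a := 96 / ε) (by positivity)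
  have h1 : 1 ≤ 1 / ε := by rw [le_div_iff₀ hε]; linarith
  calc (numBlocks ε : ℝ) ≤ 96 / ε + 1 := h.le
    _ ≤ 96 / ε + 1 / ε := by gcongr
    _ = 97 / ε := by ring

theorem log_add_one_le {t : ℕ} (ht : 1 ≤ t) : Nat.log 2 t + 1 ≤ t :=
  Nat.log_lt_self 2 (by omega)

/-- The lower bound makes the combinations erased within a block a small fraction of all; the upper
bound keeps linear dependence rare. -/
theorem le_two_pow_reserveSize {t : ℕ} (ht : 1 ≤ t) :
    1024 * t ^ 2 ≤ 2 ^ (reserveSize t + 1) ∧ 2 ^ (reserveSize t + 1) ≤ 4096 * t ^ 2 := by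
  have h : 2 ^ (reserveSize t + 1) = 4096 * (2 ^ Nat.log 2 t) ^ 2 := by
    rw [reserveSize, ← pow_mul, mul_comm (Nat.log 2 t)]
    rw [show 2 * Nat.log 2 t + 11 + 1 = 2 * Nat.log 2 t + 12 by ring, pow_add]
    norm_num
    ring
  have h1 : 2 ^ Nat.log 2 t ≤ t := Nat.pow_log_le_self 2 (by omega)
  have h2 : t ≤ 2 * 2 ^ Nat.log 2 t := by
    have := (Nat.lt_pow_succ_log_self (b := 2) one_lt_two t).le
    rwa [pow_succ, mul_comm] at this
  rw [h]
  constructor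
  · calc 1024 * t ^ 2 ≤ 1024 * (2 * 2 ^ Nat.log 2 t) ^ 2 := by gcongr
      _ = _ := by ring
  · gcongr

/-- The number of the queries of the tester is as small as required. -/
theorem numBlocks_mul_le {ε : ℝ} (hε : 0 < ε) (hε' : ε ≤ 1 / 2) {t : ℕ} (ht : 1 ≤ t) :
    (numBlocks ε : ℝ) * (reserveSize t + 1 + 1 : ℕ) ≤
      1261 * min (1 / ε * Real.logb 2 (t / ε)) (t / ε) := by
  have ht0 : (0 : ℝ) < t := by exact_mod_cast ht
  have hlog : (Nat.log 2 t : ℝ) + 1 ≤ Real.logb 2 (t / ε) := by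
    rw [Real.le_logb_iff_rpow_le one_lt_two (by positivity), Real.rpow_add two_pos,
      Real.rpow_natCast, Real.rpow_one, le_div_iff₀ hε]
    have h1 : (2 : ℝ) ^ Nat.log 2 t ≤ t := by exact_mod_cast Nat.pow_log_le_self 2 (by omega)
    have h2 : (0 : ℝ) < 2 ^ Nat.log 2 t := by positivity
    nlinarith
  have hlog' : (Nat.log 2 t : ℝ) + 1 ≤ t := by exact_mod_cast log_add_one_le ht
  -- A block makes `2 * log t + 13` queries; the final constant is `1261 = 97 * 13`.
  have hq : ((reserveSize t + 1 + 1 : ℕ) : ℝ) ≤ 13 * (Nat.log 2 t + 1) := by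
    rw [reserveSize]
    push_cast
    have : (0 : ℝ) ≤ Nat.log 2 t := by positivity
    linarith
  have hmain : (numBlocks ε : ℝ) * (reserveSize t + 1 + 1 : ℕ) ≤
      1261 * (1 / ε * (Nat.log 2 t + 1)) := by
    calc _ ≤ 97 / ε * (13 * (Nat.log 2 t + 1)) := by
          gcongr
          exact numBlocks_le hε (by linarith)
      _ = _ := by ring
  refine hmain.trans ?_
  gcongr
  refine le_min (by gcongr) ?_
  calc 1 / ε * (Nat.log 2 t + 1) ≤ 1 / ε * t := by gcongr
    _ = t / ε := by ring

theorem pow_four_le_of_le {d : ℕ} {ε : ℝ} {t : ℕ} (hε : 0 < ε)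
    (h : (t : ℝ) ≤ 1 / 100 * ε ^ (5 / 4 : ℝ) * (2 : ℝ) ^ ((d : ℝ) / 4)) :
    (t : ℝ) ^ 4 * 100000000 ≤ ε ^ 5 * Fintype.card (Cube d) := by
  have h1 : (ε ^ (5 / 4 : ℝ)) ^ 4 = ε ^ 5 := by
    rw [← Real.rpow_natCast, ← Real.rpow_mul hε.le, ← Real.rpow_natCast]
    norm_num
  have h2 : ((2 : ℝ) ^ ((d : ℝ) / 4)) ^ 4 = Fintype.card (Cube d) := by
    rw [← Real.rpow_natCast, ← Real.rpow_mul two_pos.le]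
    norm_num
  calc (t : ℝ) ^ 4 * 100000000 ≤
        (1 / 100 * ε ^ (5 / 4 : ℝ) * (2 : ℝ) ^ ((d : ℝ) / 4)) ^ 4 * 100000000 := by gcongr
    _ = (ε ^ (5 / 4 : ℝ)) ^ 4 * ((2 : ℝ) ^ ((d : ℝ) / 4)) ^ 4 := by ring
    _ = _ := by rw [h1, h2]

/-- The total number of the erasures is small enough. -/
theorem total_erasures_le {ε : ℝ} {t N : ℕ} (hε : 0 < ε) (hε' : ε ≤ 1 / 2) (ht : 1 ≤ t)
    (h : (t : ℝ) ^ 4 * 100000000 ≤ ε ^ 5 * N) :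
    (((reserveSize t + 1) * (t * (numBlocks ε * (reserveSize t + 1 + 1))) +
      2 ^ (reserveSize t + 1) + t * (numBlocks ε * (reserveSize t + 1 + 1)) : ℕ) : ℝ) ≤
      ε / 48 * N := by
  have ht1 : (1 : ℝ) ≤ t := by exact_mod_cast ht
  have hM : ((2 ^ (reserveSize t + 1) : ℕ) : ℝ) ≤ 4096 * (t : ℝ) ^ 2 := by
    exact_mod_cast (le_two_pow_reserveSize ht).2
  have hq : (reserveSize t : ℝ) + 1 + 1 ≤ 13 * t := by
    have := log_add_one_le ht
    have : reserveSize t + 1 + 1 ≤ 13 * t := by rw [reserveSize]; omega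
    exact_mod_cast this
  have hm := numBlocks_le hε (by linarith)
  have hε1 : 1 ≤ 1 / ε := by rw [le_div_iff₀ hε]; linarith
  calc _ = ((reserveSize t : ℝ) + 1 + 1) * (t * (numBlocks ε * ((reserveSize t : ℝ) + 1 + 1))) +
        ((2 ^ (reserveSize t + 1) : ℕ) : ℝ) := by push_cast; ring
    -- The crude bound of `13 * t` queries per block costs `t ^ 3 / ε`, within the allowance `t ^
    -- 4`; below, `20489 = 13 * 97 * 13 + 4096`.
    _ ≤ (13 * t) * (t * (97 / ε * (13 * t))) + 4096 * (t : ℝ) ^ 2 := by gcongr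
    _ ≤ (13 * t) * (t * (97 / ε * (13 * t))) + 4096 * ((t : ℝ) ^ 2 * t) * (1 / ε) := by
        refine add_le_add_right ?_ _
        calc 4096 * (t : ℝ) ^ 2 = 4096 * ((t : ℝ) ^ 2 * 1) * 1 := by ring
          _ ≤ _ := by gcongr
    _ = 20489 * ((t : ℝ) ^ 3 * 1) / ε := by ring
    _ ≤ 20489 * ((t : ℝ) ^ 3 * t) / ε := by gcongr
    _ ≤ 20489 * (ε ^ 5 * N / 100000000) / ε := by
        gcongr
        rw [le_div_iff₀ (by norm_num)]
        calc _ = (t : ℝ) ^ 4 * 100000000 := by ring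
          _ ≤ _ := h
    _ = ε * (N * (20489 / 100000000 * ε ^ 3)) := by field_simp
    _ ≤ ε * (N * (20489 / 100000000 * 1)) := by
        gcongr
        exact pow_le_one₀ hε.le (by linarith)
    _ ≤ ε / 48 * N := by
        have : 0 ≤ ε * N := by positivity
        linarith

/-- The ideal gain is about `ε / 12`. At most half is lost to zero coefficients and to erasures
within the block, and another `ε / 48` to the remaining errors, leaving `ε / 48`. -/
theorem card_detecting_ge_of_isFar {d t : ℕ} {ε : ℝ} (hε : 0 < ε) (hε' : ε ≤ 1 / 2) (ht : 1 ≤ t)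
    (h : (t : ℝ) ^ 4 * 100000000 ≤ ε ^ 5 * Fintype.card (Cube d)) {f : Cube d → ZMod 2}
    (hf : IsFar ε (linearity d) f) (S : Strategy (Cube d) t) (hist : List (Cube d))
    (E : Finset (Cube d))
    (hE : E.card + t * (reserveSize t + 1) ≤ t * (numBlocks ε * (reserveSize t + 1 + 1))) :
    ε / 48 * Fintype.card (Block (Cube d) (reserveSize t + 1)) ≤
      (detecting S f (reserveSize t + 1) hist E).card := by
  set Z := Finset.univ.filter fun z => Fintype.card (Cube d) ≤ 6 * (defect f z).card with hZ
  have hZcard := card_large_defect_ge hε' hf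
  rw [← hZ] at hZcard
  have hcount := card_detecting_ge S f (reserveSize t) _ hist E hE Z
    fun z hz => by simpa [hZ] using hz
  have herr := total_erasures_le hε hε' ht h
  set e := (reserveSize t + 1) * (t * (numBlocks ε * (reserveSize t + 1 + 1))) +
      2 ^ (reserveSize t + 1) + t * (numBlocks ε * (reserveSize t + 1 + 1)) with he
  have hsmall : 24 * (t * (reserveSize t + 1) + 2) ≤ 2 ^ (reserveSize t + 1) := by
    refine le_trans ?_ (le_two_pow_reserveSize ht).1
    have hq : reserveSize t + 1 ≤ 2 * t + 10 := by
      have := log_add_one_le ht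
      rw [reserveSize]; omega
    calc 24 * (t * (reserveSize t + 1) + 2) ≤ 24 * (t * (2 * t + 10) + 2) := by gcongr
      _ ≤ 1024 * t ^ 2 := by nlinarith
  have hblock : Fintype.card (Block (Cube d) (reserveSize t + 1)) =
      Fintype.card (Cube d) ^ (reserveSize t + 1) * 2 ^ (reserveSize t + 1) := by
    simp
  rw [hblock]
  have hpow : (2 : ℕ) ^ (reserveSize t + 1) = 2 * 2 ^ reserveSize t := pow_succ' _ _
  generalize (detecting S f (reserveSize t + 1) hist E).card = D at *
  have hNpos : 0 < Fintype.card (Cube d) := Fintype.card_pos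
  generalize Fintype.card (Cube d) = N at *
  have hPpos : 0 < N ^ (reserveSize t + 1) := by positivity
  generalize N ^ (reserveSize t + 1) = P at *
  generalize t * (reserveSize t + 1) = u at *
  generalize Z.card = z at *
  generalize (2 : ℕ) ^ (reserveSize t + 1) = M at *
  have hr : 1 ≤ 2 ^ reserveSize t := Nat.one_le_two_pow
  generalize (2 : ℕ) ^ reserveSize t = R at *
  subst hpow
  clear_value e
  have hNpos' : (0 : ℝ) < N := by exact_mod_cast hNpos
  have hcount' : ((R : ℝ) - 1) * (z * P) ≤
      6 * (N * D + 2 * R * (e * P) + (u + 1) * (z * P)) := by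
    have := (Nat.cast_le (α := ℝ)).mpr hcount
    push_cast [Nat.cast_sub hr] at this
    exact this
  have hsmall' : 24 * ((u : ℝ) + 2) ≤ 2 * R := by exact_mod_cast hsmall
  have hz : (2 * R : ℝ) / 24 * (ε * N * P) ≤ (R - 1 - 6 * (u + 1)) / 6 * (z * P) := by
    have h1 : (2 * R : ℝ) / 24 ≤ (R - 1 - 6 * (u + 1)) / 6 := by linarith
    have : (0 : ℝ) ≤ 2 * R / 24 := by positivity
    gcongr
    exact this.trans h1
  have he' : 2 * (R : ℝ) * (e * P) ≤ 2 * R * (ε / 48 * N * P) := by gcongr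
  have hfinal : N * (ε / 48 * (P * (2 * R))) ≤ (N : ℝ) * D := by linarith
  have := le_of_mul_le_mul_left hfinal hNpos'
  push_cast
  exact this

theorem isTester_blockTester {d t : ℕ} {ε : ℝ} (hε : 0 < ε) (hε' : ε ≤ 1 / 2) (ht : 1 ≤ t)
    (h : (t : ℝ) ^ 4 * 100000000 ≤ ε ^ 5 * Fintype.card (Cube d)) :
    IsTester t ε (linearity d) (blockTester (Cube d) (reserveSize t + 1) (numBlocks ε)) := by
  intro f σ
  refine ⟨fun hf => ?_, fun hf => le_outcome_false fun S => ?_⟩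
  · rw [outcome_blockTester_true _ _ σ (add_of_mem_linearity hf)]
    exact ENNReal.div_le_of_le_mul (by norm_num)
  have hp : (0 : ℝ) ≤ 1 - ε / 48 := by linarith
  have hmap := map_accepts_coins_le S f (reserveSize t + 1)
    (t * (numBlocks ε * (reserveSize t + 1 + 1))) (ENNReal.ofReal (1 - ε / 48))
    (fun hist E hE => by
      have hD := card_detecting_ge_of_isFar hε hε' ht h hf S hist E hE
      refine ENNReal.div_le_of_le_mul ?_
      rw [← ENNReal.ofReal_natCast, ← ENNReal.ofReal_natCast, ← ENNReal.ofReal_mul hp]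
      refine ENNReal.ofReal_le_ofReal ?_
      rw [Finset.card_compl, Nat.cast_sub (Finset.card_le_univ _)]
      linarith) (numBlocks ε) [] ∅ (by simp)
  have hrun : (blockTester (Cube d) (reserveSize t + 1) (numBlocks ε)).map
      (fun A => A.run S f [] ∅) = (coins (Cube d) (reserveSize t + 1) (numBlocks ε)).map fun bs =>
        accepts bs (answers S f (bs.flatMap Block.queries) [] ∅) := by
    rw [blockTester, PMF.map_comp]
    congr 1
    funext bs
    exact run_ofList _ _ _ _ _ _
  rw [hrun]
  refine hmap.trans ?_
  rw [← ENNReal.ofReal_pow hp]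
  -- Thus the exponent `numBlocks ε * (ε / 48)` is at least `2`, and `exp 2 ≥ 1 + 2 = 3`.
  have hm : 96 ≤ numBlocks ε * ε := by
    rw [← div_le_iff₀ hε]
    exact Nat.le_ceil _
  have hpow : (1 - ε / 48) ^ numBlocks ε ≤ 1 / 3 := by
    calc (1 - ε / 48) ^ numBlocks ε ≤ (Real.exp (-(ε / 48))) ^ numBlocks ε := by
          gcongr
          linarith [Real.add_one_le_exp (-(ε / 48))]
      _ = (Real.exp (numBlocks ε * (ε / 48)))⁻¹ := by
          rw [← Real.exp_nat_mul, mul_neg, Real.exp_neg]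
      _ ≤ (3 : ℝ)⁻¹ := by
          gcongr
          linarith [Real.add_one_le_exp (numBlocks ε * (ε / 48))]
      _ = 1 / 3 := by norm_num
  calc ENNReal.ofReal ((1 - ε / 48) ^ numBlocks ε) ≤ ENNReal.ofReal (1 / 3) :=
        ENNReal.ofReal_le_ofReal hpow
    _ = 1 / 3 := by
        rw [ENNReal.ofReal_div_of_pos (by norm_num)]
        simp

open Classical in
/-- The tester of linearity. -/
noncomputable def linearityTester (d : ℕ) (ε : ℝ) (t : ℕ) : RandAlg (Cube d) (ZMod 2) :=
  -- For `ε > 1/2` no query may be affordable: with `t = 1` the bound tends to `0` as `ε → 1`. None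
  -- is needed, since in positive dimension no function is that far from linear.
  if ε ≤ 1 / 2 then blockTester (Cube d) (reserveSize t + 1) (numBlocks ε)
  else PMF.pure (QueryAlg.output true)

end OnlineErasure

theorem theorem1p1 :
    ∃ c₀ : ℝ, 0 < c₀ ∧ c₀ < 1 ∧ ∃ C : ℝ, 0 < C ∧
      ∃ T : (d : ℕ) → (ε : ℝ) → (t : ℕ) → OnlineErasure.RandAlg (OnlineErasure.Cube d) (ZMod 2),
        ∀ (d : ℕ) (ε : ℝ) (t : ℕ), 0 < ε → ε < 1 → 1 ≤ t →
          (t : ℝ) ≤ c₀ * ε ^ (5 / 4 : ℝ) * (2 : ℝ) ^ ((d : ℝ) / 4) →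
            OnlineErasure.IsTester t ε (OnlineErasure.linearity d) (T d ε t) ∧
            OnlineErasure.IsOneSided t (OnlineErasure.linearity d) (T d ε t) ∧
            OnlineErasure.IsNonadaptive (T d ε t) ∧
            ∀ A ∈ (T d ε t).support,
              (A.numQueries : ℝ) ≤ C * min (1 / ε * Real.logb 2 (t / ε)) (t / ε) := by
  open OnlineErasure in
  refine ⟨1 / 100, by norm_num, by norm_num, 1261, by norm_num, linearityTester,
    fun d ε t hε hε1 ht h => ?_⟩
  have h4 := pow_four_le_of_le hε h
  by_cases hε' : ε ≤ 1 / 2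
  · rw [linearityTester, if_pos hε']
    refine ⟨isTester_blockTester hε hε' ht h4,
      fun f hf σ => outcome_blockTester_true _ _ σ (add_of_mem_linearity hf),
      isNonadaptive_blockTester _ _, fun A hA => ?_⟩
    rw [numQueries_of_mem_support_blockTester hA, Nat.cast_mul]
    exact numBlocks_mul_le hε hε' ht
  · rw [linearityTester, if_neg hε']
    rw [not_le] at hε'
    have ht1 : (1 : ℝ) ≤ t := by exact_mod_cast ht
    -- Dimension zero must be excluded, as there the constant `1` is far from linear; the bound on
    -- `t` would read `t ^ 4 * 10 ^ 8 ≤ ε ^ 5`.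
    have hd : 0 < d := by
      by_contra hd
      obtain rfl : d = 0 := by omega
      have h1 : (1 : ℝ) ≤ (t : ℝ) ^ 4 := one_le_pow₀ ht1
      have h2 : ε ^ 5 ≤ 1 := pow_le_one₀ hε.le hε1.le
      simp only [Fintype.card_unique, Nat.cast_one, mul_one] at h4
      linarith
    have hacc : ∀ (f : Cube d → ZMod 2) (σ : RandStrategy (Cube d) t),
        outcome (PMF.pure (QueryAlg.output true)) σ f true = 1 := fun f σ =>
      outcome_eq_pure fun S A hA => by
        rw [PMF.mem_support_pure_iff] at hA
        rw [hA]; rfl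
    refine ⟨fun f σ => ⟨fun _ => ?_, fun hf => absurd hf (not_isFar_linearity hd hε' f)⟩,
      fun f _ σ => hacc f σ, fun A hA => ?_, fun A hA => ?_⟩
    · rw [hacc]
      exact ENNReal.div_le_of_le_mul (by norm_num)
    · rw [PMF.mem_support_pure_iff] at hA
      exact ⟨[], by rw [hA]; rfl⟩
    · rw [PMF.mem_support_pure_iff] at hA
      have hlog : 0 ≤ Real.logb 2 (t / ε) :=
        Real.logb_nonneg one_lt_two (by rw [le_div_iff₀ hε]; linarith)
      rw [hA, QueryAlg.numQueries, Nat.cast_zero]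
      have : 0 ≤ min (1 / ε * Real.logb 2 (t / ε)) (t / ε) := le_min (by positivity) (by positivity)
      positivity
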